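/- For $n\ge 1$ and $\ell\in\mathbb Z$ let $\hat Q_3(1,-1,n,\ell)$ be the link in $S^3$ obtained as the closure of the three-strand braid $(\sigma_1\sigma_2^{-1})^n(\sigma_1\sigma_2)^{3\ell}$. Its Alexander polynomial is a generator of the first elementary ideal in $\mathbb Z[t,t^{-1}]$ of the link group (all meridians being sent to $t$), normalized by $\Delta(t^{-1})=\Delta(t)$, hence unique up to sign; write $t=q^2$. Fix $\ell\in\mathbb Z$. Then for all $n\ge1$ the links $\hat Q_3(1,-1,n,\ell)$ and $\hat Q_3(1,-1,n,0)$ have normalized Alexander polynomials $$\Delta^{n,\ell}(q)=\sum_i \mu^{\ell}_{(n,i)}q^{2i},\qquad \Delta^{n,0}(q)=\sum_i \mu^{0}_{(n,i)}q^{2i},$$ and their signs can be chosen such that the following holds. (a) The two polynomials are asymptotically equal: for every $\varepsilon>0$ there is $N$ such that $|\mu^{\ell}_{(n,i)}-\mu^{0}_{(n,i)}|\le\varepsilon\,|\mu^{0}_{(n,i)}|$ for all $n\ge N$ and all $i\in\mathbb Z$. (b) There is $N\geq 1$ (depending on $\ell$) such that for all $n\ge N$ the absolute values of the coefficients of both polynomials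 are trapezoidal. That is, for $\mu_{(n,i)}=\mu^{\ell}_{(n,i)}$ and for $\mu_{(n,i)}=\mu^{0}_{(n,i)}$: $\mu_{(n,i)}=0$ for $|i|>n-1$; $|\mu_{(n,-i)}|=|\mu_{(n,i)}|$ for all $i$; and there is $0\le k\le n-1$ with $|\mu_{(n,0)}|=\dots=|\mu_{(n,k)}|$ and $|\mu_{(n,k)}|>|\mu_{(n,k+1)}|>\dots>|\mu_{(n,n-1)}|>0$. In particular $|\mu_{(n,i)}|-|\mu_{(n,i+1)}|\ge 0$ for all $i\ge 0$. -/

import Mathlib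

open scoped LaurentPolynomial

noncomputable section

namespace ClosedBraid

/-- A braid word on `k + 1` strands: the letter `(i, true)` is the generator `σ_i`, the letter
`(i, false)` is its inverse (`i = 0, …, k - 1`). -/
abbrev BraidWord (k : ℕ) := List (Fin k × Bool)

/-- The Artin action of one letter on the free group on the meridians `x_0, …, x_k`.
`σ_i` sends `x_i ↦ x_i x_{i+1} x_i⁻¹` and `x_{i+1} ↦ x_i`;
`σ_i⁻¹` sends `x_i ↦ x_{i+1}` and `x_{i+1} ↦ x_{i+1}⁻¹ x_i x_{i+1}`;
the other meridians are fixed. -/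
def artinLetter {k : ℕ} (a : Fin k × Bool) : Monoid.End (FreeGroup (Fin (k + 1))) :=
  FreeGroup.lift fun j =>
    let u : FreeGroup (Fin (k + 1)) := FreeGroup.of a.1.castSucc
    let v : FreeGroup (Fin (k + 1)) := FreeGroup.of a.1.succ
    if j = a.1.castSucc then (if a.2 then u * v * u⁻¹ else v)
    else if j = a.1.succ then (if a.2 then u else v⁻¹ * u * v)
    else FreeGroup.of j

/-- The Artin action of a braid word (multiplication of endomorphisms is composition). -/
def artin {k : ℕ} (w : BraidWord k) : Monoid.End (FreeGroup (Fin (k + 1))) :=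
  (w.map artinLetter).prod

/-- The relators `β(x_j) x_j⁻¹` of Artin's presentation
`⟨x_0, …, x_k ∣ x_j = β(x_j)⟩` of the group of the link that is the closure of the braid `β`. -/
def relator {k : ℕ} (w : BraidWord k) (j : Fin (k + 1)) : FreeGroup (Fin (k + 1)) :=
  artin w (FreeGroup.of j) * (FreeGroup.of j)⁻¹

theorem T_one_mul_T_neg_one :
    (LaurentPolynomial.T 1 : ℤ[T;T⁻¹]) * LaurentPolynomial.T (-1) = 1 := by
  rw [← LaurentPolynomial.T_add]
  exact LaurentPolynomial.T_zero

theorem T_neg_one_mul_T_one :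
    (LaurentPolynomial.T (-1) : ℤ[T;T⁻¹]) * LaurentPolynomial.T 1 = 1 := by
  rw [← LaurentPolynomial.T_add]
  exact LaurentPolynomial.T_zero

/-- The image of the generator `x_i` in the Magnus representation attached to the
`j`-th Fox derivative: the matrix with rows `(t, δ_{ij})` and `(0, 1)`. -/
def magnusGen {m : ℕ} (j i : Fin m) : (Matrix (Fin 2) (Fin 2) ℤ[T;T⁻¹])ˣ where
  val := !![LaurentPolynomial.T 1, if i = j then 1 else 0; 0, 1]
  inv := !![LaurentPolynomial.T (-1),
    -(LaurentPolynomial.T (-1) * if i = j then 1 else 0); 0, 1]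
  val_inv := by
    rw [Matrix.mul_fin_two, Matrix.one_fin_two, T_one_mul_T_neg_one, mul_neg, ← mul_assoc,
      T_one_mul_T_neg_one]
    ring_nf
  inv_val := by
    rw [Matrix.mul_fin_two, Matrix.one_fin_two, T_neg_one_mul_T_one]
    ring_nf

/-- The Magnus representation of the free group: `g` is sent to the matrix with rows
`(t ^ e(g), ∂g/∂x_j)` and `(0, 1)`, where `e(g)` is the exponent sum of `g`. -/
def magnus {m : ℕ} (j : Fin m) : FreeGroup (Fin m) →* (Matrix (Fin 2) (Fin 2) ℤ[T;T⁻¹])ˣ :=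
  FreeGroup.lift (magnusGen j)

/-- The Fox derivative `∂g/∂x_j`, evaluated in `ℤ[t, t⁻¹]` by sending every generator to `t`.
See `foxDeriv_one`, `foxDeriv_of`, `foxDeriv_mul` for the rules that determine it. -/
def foxDeriv {m : ℕ} (j : Fin m) (g : FreeGroup (Fin m)) : ℤ[T;T⁻¹] :=
  (magnus j g : Matrix (Fin 2) (Fin 2) ℤ[T;T⁻¹]) 0 1

/-- The homomorphism from the free group to the units of `ℤ[t, t⁻¹]` with `x_i ↦ t`. -/
def abelianize {m : ℕ} : FreeGroup (Fin m) →* ℤ[T;T⁻¹]ˣ :=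
  FreeGroup.lift fun _ =>
    ⟨LaurentPolynomial.T 1, LaurentPolynomial.T (-1),
      T_one_mul_T_neg_one, T_neg_one_mul_T_one⟩

theorem foxDeriv_one {m : ℕ} (j : Fin m) : foxDeriv j 1 = 0 := by
  simp [foxDeriv]

theorem foxDeriv_of {m : ℕ} (i j : Fin m) :
    foxDeriv j (FreeGroup.of i) = if i = j then 1 else 0 := by
  simp [foxDeriv, magnus, magnusGen]

theorem magnus_shape {m : ℕ} (j : Fin m) (g : FreeGroup (Fin m)) :
    (magnus j g : Matrix (Fin 2) (Fin 2) ℤ[T;T⁻¹]) 0 0 = (abelianize g : ℤ[T;T⁻¹]) ∧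
    (magnus j g : Matrix (Fin 2) (Fin 2) ℤ[T;T⁻¹]) 1 0 = 0 ∧
    (magnus j g : Matrix (Fin 2) (Fin 2) ℤ[T;T⁻¹]) 1 1 = 1 := by
  induction g using FreeGroup.induction_on with
  | C1 => simp
  | of i => simp [magnus, magnusGen, abelianize]
  | inv_of i _ =>
    simp [magnus, magnusGen, abelianize, Units.inv_mk]
  | mul a b ha hb =>
    obtain ⟨a1, a2, a3⟩ := ha
    obtain ⟨b1, b2, b3⟩ := hb
    simp [Matrix.mul_apply, Fin.sum_univ_two, a1, a2, a3, b1, b2, b3]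

theorem foxDeriv_mul {m : ℕ} (j : Fin m) (g h : FreeGroup (Fin m)) :
    foxDeriv j (g * h) = foxDeriv j g + (abelianize g : ℤ[T;T⁻¹]) * foxDeriv j h := by
  have hg := magnus_shape j g
  have hh := magnus_shape j h
  simp [foxDeriv, Matrix.mul_apply, Fin.sum_univ_two, hg.1, hh.2.2, add_comm]

/-- The Alexander matrix of the closure of a braid word: the Fox Jacobian of the presentation of
its link group, all meridians being sent to `t`. -/
def alexanderMatrix {k : ℕ} (w : BraidWord k) :
    Matrix (Fin (k + 1)) (Fin (k + 1)) ℤ[T;T⁻¹] :=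
  Matrix.of fun j i => foxDeriv i (relator w j)

/-- The Alexander ideal (first elementary ideal) of the closure of a braid word: the ideal
generated by all the minors of the Alexander matrix with one row and one column deleted. -/
def alexanderIdeal {k : ℕ} (w : BraidWord k) : Ideal ℤ[T;T⁻¹] :=
  Ideal.span (Set.range fun p : Fin (k + 1) × Fin (k + 1) =>
    ((alexanderMatrix w).submatrix p.1.succAbove p.2.succAbove).det)

/-- `D` is a symmetric Alexander polynomial of the closure of the braid word `w`: it
generates the Alexander ideal and is invariant under `t ↦ t⁻¹`. Since the units of `ℤ[t, t⁻¹]` are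
`± t ^ m`, such a `D` is unique up to sign. -/
structure IsAlexanderPolynomial {k : ℕ} (w : BraidWord k) (D : ℤ[T;T⁻¹]) : Prop where
  span_eq : Ideal.span {D} = alexanderIdeal w
  symm : ∀ i : ℤ, D.coeff (-i) = D.coeff i

/-- The word `v` repeated `n` times. -/
def wordPow {k : ℕ} (v : BraidWord k) (n : ℕ) : BraidWord k :=
  (List.replicate n v).flatten

/-- The twist `(σ₁ σ₂) ^ (3 ℓ)`. -/
def twist (ℓ : ℤ) : BraidWord 2 :=
  if 0 ≤ ℓ then wordPow [(0, true), (1, true)] (3 * ℓ.natAbs)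
  else wordPow [(1, false), (0, false)] (3 * ℓ.natAbs)

/-- The three-strand braid word `(σ₁ ^ m₁ σ₂ ^ (-m₂)) ^ n (σ₁ σ₂) ^ (3 ℓ)`, whose closure is the
twisted generalized hybrid weaving link `Q̂₃(m₁, -m₂, n, ℓ)`. -/
def weavingBraid (m₁ m₂ n : ℕ) (ℓ : ℤ) : BraidWord 2 :=
  wordPow (List.replicate m₁ (0, true) ++ List.replicate m₂ (1, false)) n ++ twist ℓ

/-- The absolute values of the coefficients of `D = ∑_{|i| ≤ d} μ_i t ^ i` are trapezoidal:
they are symmetric about `0`, constant on a plateau `|i| ≤ k`, and outside the plateau they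
decrease strictly until they vanish beyond `|i| = d`. -/
def IsTrapezoidal (D : ℤ[T;T⁻¹]) (d : ℕ) : Prop :=
  (∀ i : ℤ, |D.coeff (-i)| = |D.coeff i|) ∧
  (∀ i : ℤ, (d : ℤ) < |i| → D.coeff i = 0) ∧
  ∃ k : ℕ, k ≤ d ∧
    (∀ i : ℕ, i < k → |D.coeff ((i : ℤ) + 1)| = |D.coeff (i : ℤ)|) ∧
    (∀ i : ℕ, k ≤ i → i ≤ d → |D.coeff ((i : ℤ) + 1)| < |D.coeff (i : ℤ)|)

end ClosedBraid

end

noncomputable section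

namespace ClosedBraid

open LaurentPolynomial Matrix

/-! ### Fox calculus: the chain rule -/

/-! Everything follows from one identity: the Alexander polynomial is `weavingPoly n + C`, where the
Laurent polynomial `C` depends on ℓ but not on n.

By the Fox chain rule the Alexander matrix is the Burau matrix minus 1. Its kernel vectors (1,1,1)
on the right and (1,t,t²) on the left make all 2×2 minors multiples of a single one, and that one
times 1+t+t² is det(R - 1), with R the reduced Burau matrix (`alexanderIdeal_eq_span`). Here R =
t^(3ℓ) Mⁿ, since the full twist acts as a scalar, and det M = 1. So det(R - 1) = t^(3ℓ) (t^(3ℓ) +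
t^(-3ℓ) - tr Mⁿ). Both tr Mⁿ and t^(3ℓ) + t^(-3ℓ) are 2 modulo t+1+t⁻¹; the two quotients give
`weavingPoly n` and `C`.

The coefficients of `weavingPoly n` alternate in sign, and the consecutive gaps of their absolute
values are positive up to degree n-1 and tend to infinity with n at each fixed index
(`weavingGap_pos`, `tendsto_weavingGap`). As `C` has bounded coefficients and finite support, adding
it is asymptotically negligible and, for large n, does not disturb the strict decrease. -/

theorem foxDeriv_inv {m : ℕ} (j : Fin m) (g : FreeGroup (Fin m)) :
    foxDeriv j g⁻¹ = -((abelianize g⁻¹ : ℤ[T;T⁻¹]ˣ) : ℤ[T;T⁻¹]) * foxDeriv j g := by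
  have h := foxDeriv_mul j g⁻¹ g
  rw [inv_mul_cancel, foxDeriv_one] at h
  linear_combination -h

theorem abelianize_of {m : ℕ} (i : Fin m) :
    ((abelianize (FreeGroup.of i) : ℤ[T;T⁻¹]ˣ) : ℤ[T;T⁻¹]) = T 1 := by
  simp [abelianize]

theorem abelianize_of_inv {m : ℕ} (i : Fin m) :
    ((abelianize (FreeGroup.of i)⁻¹ : ℤ[T;T⁻¹]ˣ) : ℤ[T;T⁻¹]) = T (-1) := by
  simp [abelianize, Units.inv_mk]

/-- The chain rule of Fox calculus, for endomorphisms that preserve the exponent sum. -/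
theorem foxDeriv_map {m : ℕ} (φ : Monoid.End (FreeGroup (Fin m)))
    (hφ : ∀ g, abelianize (φ g) = abelianize g) (i : Fin m) (g : FreeGroup (Fin m)) :
    foxDeriv i (φ g) = ∑ l, foxDeriv l g * foxDeriv i (φ (FreeGroup.of l)) := by
  induction g using FreeGroup.induction_on with
  | C1 => simp [foxDeriv_one]
  | of a => simp [foxDeriv_of]
  | inv_of a h =>
    rw [map_inv, foxDeriv_inv, ← map_inv, hφ, h, Finset.mul_sum]
    refine Finset.sum_congr rfl fun l _ => ?_
    rw [foxDeriv_inv, mul_assoc]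
  | mul a b ha hb =>
    rw [map_mul, foxDeriv_mul, hφ, ha, hb, Finset.mul_sum, ← Finset.sum_add_distrib]
    refine Finset.sum_congr rfl fun l _ => ?_
    rw [foxDeriv_mul]
    ring

/-- The Fox Jacobian of an endomorphism of the free group. -/
def foxJacobian {m : ℕ} (φ : Monoid.End (FreeGroup (Fin m))) : Matrix (Fin m) (Fin m) ℤ[T;T⁻¹] :=
  Matrix.of fun j i => foxDeriv i (φ (FreeGroup.of j))

theorem foxJacobian_one {m : ℕ} : foxJacobian (1 : Monoid.End (FreeGroup (Fin m))) = 1 := by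
  ext1 j i
  simp [foxJacobian, foxDeriv_of, Matrix.one_apply]

theorem foxJacobian_mul {m : ℕ} (φ ψ : Monoid.End (FreeGroup (Fin m)))
    (hφ : ∀ g, abelianize (φ g) = abelianize g) :
    foxJacobian (φ * ψ) = foxJacobian ψ * foxJacobian φ := by
  ext1 j i
  simp [foxJacobian, Matrix.mul_apply, foxDeriv_map φ hφ i (ψ (FreeGroup.of j))]

theorem abelianize_artinLetter {k : ℕ} (a : Fin k × Bool) (g : FreeGroup (Fin (k + 1))) :
    abelianize (artinLetter a g) = abelianize g := by
  have h : (abelianize (m := k + 1)).comp (artinLetter a) = abelianize := by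
    ext1 j
    have hc (i i' : Fin (k + 1)) :
        abelianize (FreeGroup.of i) = abelianize (FreeGroup.of i') := by simp [abelianize]
    simp only [MonoidHom.comp_apply, artinLetter, FreeGroup.lift_apply_of]
    split_ifs <;> simp [hc _ j]
  exact DFunLike.congr_fun h g

theorem abelianize_artin {k : ℕ} (w : BraidWord k) (g : FreeGroup (Fin (k + 1))) :
    abelianize (artin w g) = abelianize g := by
  induction w with
  | nil => simp [artin]
  | cons a w ih =>
    have : artin (a :: w) = artinLetter a * artin w := by simp [artin]
    rw [this, Monoid.End.coe_mul, Function.comp_apply, abelianize_artinLetter, ih]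

theorem foxJacobian_artin_cons {k : ℕ} (a : Fin k × Bool) (w : BraidWord k) :
    foxJacobian (artin (a :: w)) = foxJacobian (artin w) * foxJacobian (artinLetter a) := by
  have : artin (a :: w) = artinLetter a * artin w := by simp [artin]
  rw [this, foxJacobian_mul _ _ (abelianize_artinLetter a)]

/-- The factor t contributed by β(x_j) cancels the t⁻¹ from differentiating x_j⁻¹, because β
preserves exponent sums. -/
theorem alexanderMatrix_eq {k : ℕ} (w : BraidWord k) :
    alexanderMatrix w = foxJacobian (artin w) - 1 := by
  ext1 j i
  simp only [alexanderMatrix, relator, foxJacobian, of_apply, Matrix.sub_apply, foxDeriv_mul,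
    foxDeriv_inv, abelianize_artin, abelianize_of, abelianize_of_inv, foxDeriv_of, one_apply]
  linear_combination -(if j = i then 1 else 0) * T_one_mul_T_neg_one

/-! ### The Burau representation on three strands -/

/-- The Fox Jacobians of the generators of the three-strand braid group. -/
def burauLetter : Fin 2 × Bool → Matrix (Fin 3) (Fin 3) ℤ[T;T⁻¹]
  | (0, true) => !![1 - T 1, T 1, 0; 1, 0, 0; 0, 0, 1]
  | (1, true) => !![1, 0, 0; 0, 1 - T 1, T 1; 0, 1, 0]
  | (0, false) => !![0, 1, 0; T (-1), 1 - T (-1), 0; 0, 0, 1]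
  | (1, false) => !![1, 0, 0; 0, 0, 1; 0, T (-1), 1 - T (-1)]

theorem foxJacobian_artinLetter (a : Fin 2 × Bool) :
    foxJacobian (artinLetter a) = burauLetter a := by
  have hT := T_one_mul_T_neg_one
  match a with
  | (0, true) =>
    have e₀ : artinLetter (0, true) (FreeGroup.of (0 : Fin 3)) = .of 0 * .of 1 * (.of 0)⁻¹ := rfl
    have e₁ : artinLetter (0, true) (FreeGroup.of (1 : Fin 3)) = .of 0 := rfl
    have e₂ : artinLetter (0, true) (FreeGroup.of (2 : Fin 3)) = .of 2 := rfl
    ext1 j i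
    rw [foxJacobian, of_apply]
    fin_cases j <;> simp only [Fin.zero_eta, Fin.mk_one, Fin.reduceFinMk, e₀, e₁, e₂, burauLetter,
        foxDeriv_mul, foxDeriv_inv, foxDeriv_of, map_mul, Units.val_mul, abelianize_of,
        abelianize_of_inv] <;>
      generalize (T 1 : ℤ[T;T⁻¹]) = t, (T (-1) : ℤ[T;T⁻¹]) = s at hT ⊢ <;> fin_cases i <;> simp <;> grind
  | (1, true) =>
    have e₀ : artinLetter (1, true) (FreeGroup.of (0 : Fin 3)) = .of 0 := rfl
    have e₁ : artinLetter (1, true) (FreeGroup.of (1 : Fin 3)) = .of 1 * .of 2 * (.of 1)⁻¹ := rfl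
    have e₂ : artinLetter (1, true) (FreeGroup.of (2 : Fin 3)) = .of 1 := rfl
    ext1 j i
    rw [foxJacobian, of_apply]
    fin_cases j <;> simp only [Fin.zero_eta, Fin.mk_one, Fin.reduceFinMk, e₀, e₁, e₂, burauLetter,
        foxDeriv_mul, foxDeriv_inv, foxDeriv_of, map_mul, Units.val_mul, abelianize_of,
        abelianize_of_inv] <;>
      generalize (T 1 : ℤ[T;T⁻¹]) = t, (T (-1) : ℤ[T;T⁻¹]) = s at hT ⊢ <;> fin_cases i <;> simp <;> grind
  | (0, false) =>
    have e₀ : artinLetter (0, false) (FreeGroup.of (0 : Fin 3)) = .of 1 := rfl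
    have e₁ : artinLetter (0, false) (FreeGroup.of (1 : Fin 3)) = (.of 1)⁻¹ * .of 0 * .of 1 := rfl
    have e₂ : artinLetter (0, false) (FreeGroup.of (2 : Fin 3)) = .of 2 := rfl
    ext1 j i
    rw [foxJacobian, of_apply]
    fin_cases j <;> simp only [Fin.zero_eta, Fin.mk_one, Fin.reduceFinMk, e₀, e₁, e₂, burauLetter,
        foxDeriv_mul, foxDeriv_inv, foxDeriv_of, map_mul, Units.val_mul, abelianize_of,
        abelianize_of_inv] <;>
      generalize (T 1 : ℤ[T;T⁻¹]) = t, (T (-1) : ℤ[T;T⁻¹]) = s at hT ⊢ <;> fin_cases i <;> simp <;> grind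
  | (1, false) =>
    have e₀ : artinLetter (1, false) (FreeGroup.of (0 : Fin 3)) = .of 0 := rfl
    have e₁ : artinLetter (1, false) (FreeGroup.of (1 : Fin 3)) = .of 2 := rfl
    have e₂ : artinLetter (1, false) (FreeGroup.of (2 : Fin 3)) = (.of 2)⁻¹ * .of 1 * .of 2 := rfl
    ext1 j i
    rw [foxJacobian, of_apply]
    fin_cases j <;> simp only [Fin.zero_eta, Fin.mk_one, Fin.reduceFinMk, e₀, e₁, e₂, burauLetter,
        foxDeriv_mul, foxDeriv_inv, foxDeriv_of, map_mul, Units.val_mul, abelianize_of,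
        abelianize_of_inv] <;>
      generalize (T 1 : ℤ[T;T⁻¹]) = t, (T (-1) : ℤ[T;T⁻¹]) = s at hT ⊢ <;> fin_cases i <;> simp <;> grind

/-- The reduced Burau matrices of the generators of the three-strand braid group. -/
def reducedBurauLetter : Fin 2 × Bool → Matrix (Fin 2) (Fin 2) ℤ[T;T⁻¹]
  | (0, true) => !![-T 1, 0; 1, 1]
  | (1, true) => !![1, T 1; 0, -T 1]
  | (0, false) => !![-T (-1), 0; T (-1), 1]
  | (1, false) => !![1, 1; 0, -T (-1)]

/-- The reduced Burau matrix of a three-strand braid word (an anti-homomorphism). -/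
def reducedBurau : BraidWord 2 → Matrix (Fin 2) (Fin 2) ℤ[T;T⁻¹]
  | [] => 1
  | a :: w => reducedBurau w * reducedBurauLetter a

theorem reducedBurau_append (u v : BraidWord 2) :
    reducedBurau (u ++ v) = reducedBurau v * reducedBurau u := by
  induction u with
  | nil => simp [reducedBurau]
  | cons a u ih => simp [reducedBurau, ih, Matrix.mul_assoc]

theorem reducedBurau_wordPow (v : BraidWord 2) (n : ℕ) :
    reducedBurau (wordPow v n) = reducedBurau v ^ n := by
  induction n with
  | zero => simp [wordPow, reducedBurau]
  | succ n ih =>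
    have : wordPow v (n + 1) = v ++ wordPow v n := by simp [wordPow, List.replicate_succ]
    rw [this, reducedBurau_append, ih, pow_succ]

/-- The matrix of successive differences, which intertwines the Burau representation with the
reduced one. -/
def differenceMatrix : Matrix (Fin 2) (Fin 3) ℤ[T;T⁻¹] := !![1, -1, 0; 0, 1, -1]

theorem foxJacobian_artin_relations (w : BraidWord 2) :
    foxJacobian (artin w) *ᵥ ![1, 1, 1] = ![1, 1, 1] ∧
    ![1, T 1, T 1 ^ 2] ᵥ* foxJacobian (artin w) = ![1, T 1, T 1 ^ 2] ∧
    differenceMatrix * foxJacobian (artin w) = reducedBurau w * differenceMatrix := by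
  induction w with
  | nil => simp [artin, foxJacobian_one, reducedBurau]
  | cons a w ih =>
    obtain ⟨h₁, h₂, h₃⟩ := ih
    have hT := T_one_mul_T_neg_one
    have key : burauLetter a *ᵥ ![1, 1, 1] = ![1, 1, 1] ∧
        ![1, T 1, T 1 ^ 2] ᵥ* burauLetter a = ![1, T 1, T 1 ^ 2] ∧
        differenceMatrix * burauLetter a = reducedBurauLetter a * differenceMatrix := by
      obtain ⟨a, b⟩ := a
      refine ⟨?_, ?_, ?_⟩
      · ext1 i
        fin_cases a <;> cases b <;> simp only [burauLetter] <;>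
          generalize (T 1 : ℤ[T;T⁻¹]) = t, (T (-1) : ℤ[T;T⁻¹]) = s at * <;> fin_cases i <;>
          simp [mulVec, dotProduct, Fin.sum_univ_three]
      · ext1 i
        fin_cases a <;> cases b <;> simp only [burauLetter] <;>
          generalize (T 1 : ℤ[T;T⁻¹]) = t, (T (-1) : ℤ[T;T⁻¹]) = s at * <;> fin_cases i <;>
          simp [vecMul, dotProduct, Fin.sum_univ_three] <;> grind
      · ext1 i j
        fin_cases a <;> cases b <;>
          simp only [burauLetter, reducedBurauLetter, differenceMatrix] <;>
          generalize (T 1 : ℤ[T;T⁻¹]) = t, (T (-1) : ℤ[T;T⁻¹]) = s at * <;> fin_cases i <;> fin_cases j <;>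
          simp [Matrix.mul_apply, Fin.sum_univ_three, Fin.sum_univ_two] <;> ring
    obtain ⟨k₁, k₂, k₃⟩ := key
    rw [foxJacobian_artin_cons, foxJacobian_artinLetter]
    refine ⟨?_, ?_, ?_⟩
    · rw [← mulVec_mulVec, k₁, h₁]
    · rw [← vecMul_vecMul, h₂, k₂]
    · rw [← Matrix.mul_assoc, h₃, Matrix.mul_assoc, k₃, reducedBurau, Matrix.mul_assoc]

/-- The Alexander ideal of a closed three-strand braid is generated by any `D` for which
`D * (1 + t + t²)` is the determinant of `1` minus the reduced Burau matrix, up to a unit. -/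
theorem alexanderIdeal_eq_span (w : BraidWord 2) (D : ℤ[T;T⁻¹]) (m : ℤ)
    (hD : (reducedBurau w - 1).det = T m * D * (1 + T 1 + T 1 ^ 2)) :
    Ideal.span {D} = alexanderIdeal w := by
  obtain ⟨h₁, h₂, h₃⟩ := foxJacobian_artin_relations w
  set A : Matrix (Fin 3) (Fin 3) ℤ[T;T⁻¹] := alexanderMatrix w with hA
  have hJ : foxJacobian (artin w) = A + 1 := by rw [hA, alexanderMatrix_eq, sub_add_cancel]
  rw [hJ] at h₁ h₂ h₃
  rw [add_mulVec, one_mulVec, add_eq_right] at h₁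
  rw [vecMul_add, vecMul_one, add_eq_right] at h₂
  have h₄ : differenceMatrix * A = (reducedBurau w - 1) * differenceMatrix := by
    rw [Matrix.sub_mul, ← h₃, Matrix.mul_add]
    simp
  set S := reducedBurau w - 1
  obtain ⟨t, ht⟩ : ∃ t : ℤ[T;T⁻¹], t = T 1 := ⟨_, rfl⟩
  rw [← ht] at h₂ hD
  have hc (i : Fin 3) : A i 2 = -A i 0 - A i 1 := by
    have := congrFun h₁ i
    simp [mulVec, dotProduct, Fin.sum_univ_three] at this
    linear_combination this
  have hr (i : Fin 3) : A 0 i = -t * A 1 i - t ^ 2 * A 2 i := by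
    have := congrFun h₂ i
    simp [vecMul, dotProduct, Fin.sum_univ_three] at this
    linear_combination this
  have hd (i : Fin 2) (j : Fin 3) := congrFun (congrFun h₄ i) j
  simp only [differenceMatrix, Matrix.mul_apply, Fin.sum_univ_three, Fin.sum_univ_two] at hd
  have e00 := hd 0 0
  have e01 := hd 0 1
  have e10 := hd 1 0
  have e11 := hd 1 1
  simp at e00 e01 e10 e11
  -- The intertwining relation expresses the entries of `S` through `A`; the left kernel vector then
  -- removes row 0.
  have hS : S.det = (A 1 0 * A 2 1 - A 1 1 * A 2 0) * (1 + t + t ^ 2) := by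
    have h01 : S 0 1 = A 0 1 + A 0 0 - A 1 1 - A 1 0 := by linear_combination -e01 - e00
    have h11 : S 1 1 = A 1 1 + A 1 0 - A 2 1 - A 2 0 := by linear_combination -e11 - e10
    rw [det_fin_two, ← e00, ← e10, h01, h11, hr 0, hr 1]
    ring
  have hne : 1 + t + t ^ 2 ≠ 0 := fun h => by
    have := congrArg (fun f : ℤ[T;T⁻¹] => f.coeff 0) h
    simp [ht, T_pow, ← T_zero] at this
  have hcD : A 1 0 * A 2 1 - A 1 1 * A 2 0 = T m * D :=
    mul_right_cancel₀ hne (hS.symm.trans hD)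
  apply le_antisymm
  · rw [Ideal.span_singleton_le_iff_mem, ← Ideal.unit_mul_mem_iff_mem _ (isUnit_T m), ← hcD]
    refine Ideal.subset_span ⟨(0, 2), ?_⟩
    simp [det_fin_two, Fin.succAbove, hA]
  · rw [alexanderIdeal, Ideal.span_le]
    rintro _ ⟨⟨p, q⟩, rfl⟩
    have : ∃ u : ℤ[T;T⁻¹], ((alexanderMatrix w).submatrix p.succAbove q.succAbove).det
      = u * (A 1 0 * A 2 1 - A 1 1 * A 2 0) := by
      rw [← hA]
      -- Replacing row 0 by -t·row 1 - t²·row 2 and column 2 by -column 0 - column 1 turns each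
      -- minor into the one without row 0 and column 2, up to these factors.
      refine ⟨![1, -t, t ^ 2] p * ![1, -1, 1] q, ?_⟩
      fin_cases p <;> fin_cases q <;> simp [det_fin_two, Fin.succAbove] <;>
        (simp only [hr, hc]; ring)
    obtain ⟨u, hu⟩ := this
    rw [SetLike.mem_coe, Ideal.mem_span_singleton]
    exact ⟨u * T m, by linear_combination hu + u * hcD⟩

/-! ### Alexander polynomials of weaving links -/

/-- The symmetric Alexander polynomial of the closure of `(σ₁ σ₂⁻¹) ^ n`. -/
def weavingPoly : ℕ → ℤ[T;T⁻¹]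
  -- The value at 0 lets the recurrence and the trace formula start at n = 0, where tr 1 = 2.
  | 0 => 0
  | 1 => 1
  | n + 2 => (1 - T 1 - T (-1)) * weavingPoly (n + 1) - weavingPoly n + 2

/-- Cayley–Hamilton gives tr Mⁿ⁺² = tr M · tr Mⁿ⁺¹ - tr Mⁿ. Since tr M = 2 - (t+1+t⁻¹), the
recurrence of `weavingPoly`, with its constant 2, is what remains after dividing by t+1+t⁻¹. -/
theorem trace_pow_eq_weavingPoly (M : Matrix (Fin 2) (Fin 2) ℤ[T;T⁻¹]) (hdet : M.det = 1)
    (htr : M.trace = 1 - T 1 - T (-1)) (n : ℕ) :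
    (M ^ n).trace = 2 - (T 1 + 1 + T (-1)) * weavingPoly n := by
  have hCH : M ^ 2 = M.trace • M - 1 := by
    have h := hdet
    rw [det_fin_two] at h
    ext1 i j
    fin_cases i <;> fin_cases j <;>
      simp [sq, Matrix.mul_apply, trace_fin_two] <;> grind
  induction n using Nat.twoStepInduction with
  | zero => simp [weavingPoly]
  | one => rw [pow_one, htr, weavingPoly]; ring
  | more n h₁ h₂ =>
    rw [pow_add, hCH, Matrix.mul_sub, Matrix.mul_smul, ← pow_succ, mul_one, trace_sub, trace_smul,
      h₁, h₂, htr, weavingPoly, smul_eq_mul]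
    ring

theorem reducedBurau_twist (ℓ : ℤ) : reducedBurau (twist ℓ) = (T (3 * ℓ) : ℤ[T;T⁻¹]) • 1 := by
  have pos : reducedBurau [(0, true), (1, true)] ^ 3 = (T 3 : ℤ[T;T⁻¹]) • 1 := by
    have h3 : (T 3 : ℤ[T;T⁻¹]) = T 1 ^ 3 := by rw [T_pow]; norm_num
    rw [h3]
    simp only [reducedBurau, reducedBurauLetter, Matrix.one_mul]
    generalize (T 1 : ℤ[T;T⁻¹]) = t
    ext1 i j
    fin_cases i <;> fin_cases j <;> simp [pow_succ, Matrix.mul_apply, Fin.sum_univ_two]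
  have neg : reducedBurau [(1, false), (0, false)] ^ 3 = (T (-3) : ℤ[T;T⁻¹]) • 1 := by
    have h3 : (T (-3) : ℤ[T;T⁻¹]) = T (-1) ^ 3 := by rw [T_pow]; norm_num
    rw [h3]
    simp only [reducedBurau, reducedBurauLetter, Matrix.one_mul]
    generalize (T (-1) : ℤ[T;T⁻¹]) = t
    ext1 i j
    fin_cases i <;> fin_cases j <;> simp [pow_succ, Matrix.mul_apply, Fin.sum_univ_two]
  rw [twist]
  split_ifs with h
  · rw [reducedBurau_wordPow, pow_mul, pos, smul_pow, one_pow, T_pow]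
    congr 2
    lia
  · rw [reducedBurau_wordPow, pow_mul, neg, smul_pow, one_pow, T_pow]
    congr 2
    lia

theorem weavingPoly_symm (n : ℕ) : invert (weavingPoly n) = weavingPoly n := by
  induction n using Nat.twoStepInduction with
  | zero => simp [weavingPoly]
  | one => simp [weavingPoly]
  | more n h₁ h₂ =>
    simp only [weavingPoly, map_add, map_sub, map_mul, h₁, h₂, invert_T, map_one, map_ofNat,
      neg_neg]
    ring

theorem T_one_add_one_add_T_neg_one_ne_zero : (T 1 + 1 + T (-1) : ℤ[T;T⁻¹]) ≠ 0 := fun h => by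
  have := congrArg (fun f : ℤ[T;T⁻¹] => f.coeff 0) h
  simp [← T_zero] at this

/-- The quotient of `t ^ (3 ℓ) + t ^ (-3 ℓ) - 2` by `t + 1 + t⁻¹` is a Laurent polynomial. -/
theorem exists_twistCorrection (ℓ : ℤ) :
    ∃ C : ℤ[T;T⁻¹], C * (T 1 + 1 + T (-1)) = T (3 * ℓ) + T (-(3 * ℓ)) - 2 := by
  wlog h : 0 ≤ ℓ generalizing ℓ
  · obtain ⟨C, hC⟩ := this (-ℓ) (by lia)
    exact ⟨C, by rw [hC, add_comm (T (3 * ℓ))]; ring_nf⟩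
  obtain ⟨m, rfl⟩ := Int.eq_ofNat_of_zero_le h
  obtain ⟨d, hd⟩ : (T 1 ^ 3 - 1 : ℤ[T;T⁻¹]) ∣ T (3 * (m : ℤ)) - 1 := by
    have : (T (3 * (m : ℤ)) : ℤ[T;T⁻¹]) = (T 1 ^ 3) ^ m := by
      rw [T_pow, T_pow]; congr 1; push_cast; ring
    rw [this]
    exact sub_one_dvd_pow_sub_one _ _
  have hT := T_one_mul_T_neg_one
  have hTm : (T (3 * (m : ℤ)) * T (-(3 * (m : ℤ))) : ℤ[T;T⁻¹]) = 1 := by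
    rw [← T_add, add_neg_cancel, T_zero]
  -- The right-hand side is t^(-3m) (t^(3m) - 1)². One factor t^(3m) - 1 is (t³ - 1) d, and t³ - 1 =
  -- (t - 1) · t · (t + 1 + t⁻¹).
  refine ⟨T (-(3 * (m : ℤ))) * d * (T 1 - 1) * (T (3 * (m : ℤ)) - 1) * T 1, ?_⟩
  generalize (T (3 * (m : ℤ)) : ℤ[T;T⁻¹]) = a, (T (-(3 * (m : ℤ))) : ℤ[T;T⁻¹]) = b,
    (T 1 : ℤ[T;T⁻¹]) = t, (T (-1) : ℤ[T;T⁻¹]) = s at *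
  linear_combination b * d * (t - 1) * (a - 1) * hT - b * (a - 1) * hd + (a - 2) * hTm

theorem isAlexanderPolynomial_weavingBraid (n : ℕ) (ℓ : ℤ) (C : ℤ[T;T⁻¹])
    (hC : C * (T 1 + 1 + T (-1)) = T (3 * ℓ) + T (-(3 * ℓ)) - 2) :
    IsAlexanderPolynomial (weavingBraid 1 1 n ℓ) (weavingPoly n + C) where
  span_eq := by
    apply alexanderIdeal_eq_span _ _ (3 * ℓ - 1)
    set M := reducedBurau [(0, true), (1, false)] with hM
    have hT := T_one_mul_T_neg_one
    have hMdet : M.det = 1 := by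
      rw [hM]
      simp only [reducedBurau, reducedBurauLetter, Matrix.one_mul]
      rw [det_mul, det_fin_two_of, det_fin_two_of]
      linear_combination hT
    have hMtr : M.trace = 1 - T 1 - T (-1) := by
      rw [hM]
      simp only [reducedBurau, reducedBurauLetter, Matrix.one_mul, mul_fin_two, trace_fin_two_of]
      ring
    have hw : reducedBurau (weavingBraid 1 1 n ℓ) = (T (3 * ℓ) : ℤ[T;T⁻¹]) • M ^ n := by
      rw [weavingBraid, reducedBurau_append, reducedBurau_twist, reducedBurau_wordPow]
      simp [hM]
    have hdetn : (M ^ n).det = 1 := by rw [det_pow, hMdet, one_pow]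
    have htrn := trace_pow_eq_weavingPoly M hMdet hMtr n
    have hTl : (T (3 * ℓ) * T (-(3 * ℓ)) : ℤ[T;T⁻¹]) = 1 := by
      rw [← T_add, add_neg_cancel, T_zero]
    rw [hw, T_sub, det_fin_two]
    rw [det_fin_two] at hdetn
    rw [trace_fin_two] at htrn
    simp only [Matrix.sub_apply, Matrix.smul_apply, smul_eq_mul, one_apply,
      Fin.isValue, zero_ne_one, one_ne_zero, if_false, if_true]
    generalize (T (3 * ℓ) : ℤ[T;T⁻¹]) = a, (T (-(3 * ℓ)) : ℤ[T;T⁻¹]) = b,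
      (T 1 : ℤ[T;T⁻¹]) = t, (T (-1) : ℤ[T;T⁻¹]) = s at *
    -- This is det(aMⁿ - 1) = a² det Mⁿ - a tr Mⁿ + 1 with a = t^(3ℓ).
    linear_combination a ^ 2 * hdetn - a * htrn - a * hC - hTl
      - a * (weavingPoly n + C) * (1 + t) * hT
  symm i := by
    have hCs : invert C = C := by
      apply mul_right_cancel₀ T_one_add_one_add_T_neg_one_ne_zero
      have := congrArg invert hC
      simp only [map_mul, map_add, map_sub, invert_T, map_one, map_ofNat, neg_neg] at this
      linear_combination this - hC
    rw [← invert_apply, map_add, hCs, weavingPoly_symm]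

end ClosedBraid

end

noncomputable section

namespace ClosedBraid

open LaurentPolynomial Filter

/-! ### The coefficients of the Alexander polynomial of weaving links -/

theorem coeff_T_mul (m i : ℤ) (f : ℤ[T;T⁻¹]) : (T m * f).coeff i = f.coeff (i - m) := by
  rw [T, AddMonoidAlgebra.coeff_single_mul_eq_mul_coeff (i - m) fun j _ => by lia, one_mul]

/-- The coefficients of `weavingPoly n`, up to the alternating sign. -/
def weavingCoeff : ℕ → ℤ → ℤ
  | 0, _ => 0
  | 1, i => if i = 0 then 1 else 0
  | n + 2, i => weavingCoeff (n + 1) (i - 1) + weavingCoeff (n + 1) i + weavingCoeff (n + 1) (i + 1)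
      - weavingCoeff n i + if i = 0 then 2 else 0

theorem coeff_weavingPoly (n : ℕ) (i : ℤ) :
    (weavingPoly n).coeff i = i.negOnePow * weavingCoeff n i := by
  induction n using Nat.twoStepInduction generalizing i with
  | zero => simp [weavingPoly, weavingCoeff]
  | one =>
    rw [weavingPoly, weavingCoeff, ← T_zero, T_apply]
    by_cases h : i = 0
    · simp [h]
    · simp [h, Ne.symm h]
  | more n h₁ h₂ =>
    have h2 : (2 : ℤ[T;T⁻¹]) = C 2 := by simp
    have hexp : weavingPoly (n + 2) = weavingPoly (n + 1) - T 1 * weavingPoly (n + 1)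
        - T (-1) * weavingPoly (n + 1) - weavingPoly n + C 2 := by
      rw [weavingPoly, h2]; ring
    rw [hexp]
    simp only [AddMonoidAlgebra.coeff_add, AddMonoidAlgebra.coeff_sub, Finsupp.add_apply,
      Finsupp.sub_apply, coeff_T_mul, C_apply, h₁, h₂, sub_neg_eq_add, Int.negOnePow_succ,
      Int.negOnePow_sub, Int.negOnePow_one, weavingCoeff]
    by_cases h : i = 0
    · simp [h]; ring
    · simp [h]; ring

theorem weavingCoeff_neg (n : ℕ) (i : ℤ) : weavingCoeff n (-i) = weavingCoeff n i := by
  induction n using Nat.twoStepInduction generalizing i with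
  | zero => simp [weavingCoeff]
  | one => simp [weavingCoeff]
  | more n h₁ h₂ =>
    simp only [weavingCoeff, h₁, neg_eq_zero]
    rw [show -i - 1 = -(i + 1) by ring, show -i + 1 = -(i - 1) by ring, h₂, h₂, h₂]
    ring

theorem weavingCoeff_eq_zero (n : ℕ) (i : ℤ) (h : (n : ℤ) ≤ |i|) : weavingCoeff n i = 0 := by
  induction n using Nat.twoStepInduction generalizing i with
  | zero => simp [weavingCoeff]
  | one =>
    have : i ≠ 0 := by rintro rfl; simp at h
    simp [weavingCoeff, this]
  | more n h₁ h₂ =>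
    push_cast at *
    rw [weavingCoeff, h₁ _ (by grind), h₂ _ (by grind), h₂ _ (by grind), h₂ _ (by grind),
      if_neg (by grind)]
    simp

/-- The difference of two consecutive coefficients of the weaving polynomial. -/
def weavingGap (n i : ℕ) : ℤ := weavingCoeff n i - weavingCoeff n (i + 1)

/-- By the symmetry of the coefficients about 0, the neighbour at -1 equals the one at 1. -/
theorem weavingGap_zero (n : ℕ) :
    weavingGap (n + 2) 0 = weavingGap (n + 1) 1 - weavingGap n 0 + 2 := by
  have := weavingCoeff_neg (n + 1) 1
  simp [weavingGap, weavingCoeff, this]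
  ring

theorem weavingGap_succ (n i : ℕ) :
    weavingGap (n + 2) (i + 1) = weavingGap (n + 1) i + weavingGap (n + 1) (i + 1)
      + weavingGap (n + 1) (i + 2) - weavingGap n (i + 1) := by
  have h₁ : (i : ℤ) + 1 ≠ 0 := by lia
  have h₂ : (i : ℤ) + 1 + 1 ≠ 0 := by lia
  simp only [weavingGap, weavingCoeff, Nat.cast_add, Nat.cast_one, Nat.cast_ofNat, h₁, h₂, if_false]
  ring_nf

/-- The diagonal inequality is what makes the induction close: it bounds the subtracted term of the
recurrence by the last positive one. -/
theorem weavingGap_nonneg_and_le (n : ℕ) :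
    (∀ i, 0 ≤ weavingGap n i) ∧ (∀ i, 0 ≤ weavingGap (n + 1) i) ∧
      ∀ i, weavingGap n i ≤ weavingGap (n + 1) (i + 1) := by
  induction n with
  | zero =>
    have h₀ (i) : weavingGap 0 i = 0 := by simp [weavingGap, weavingCoeff]
    have h₁ (i) : 0 ≤ weavingGap 1 i := by
      have h : (i : ℤ) + 1 ≠ 0 := by lia
      simp only [weavingGap, weavingCoeff, h, if_false]
      split_ifs <;> simp
    exact ⟨fun i => (h₀ i).ge, h₁, fun i => by rw [h₀]; exact h₁ _⟩
  | succ n ih =>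
    obtain ⟨h₁, h₂, h₃⟩ := ih
    have h₄ (i) : weavingGap (n + 1) i ≤ weavingGap (n + 2) (i + 1) := by
      linarith [weavingGap_succ n i, h₂ (i + 1), h₃ (i + 1)]
    refine ⟨h₂, fun i => ?_, h₄⟩
    cases i with
    | zero => linarith [weavingGap_zero n, h₃ 0]
    | succ i => exact (h₂ i).trans (h₄ i)

theorem weavingGap_nonneg (n i : ℕ) : 0 ≤ weavingGap n i := (weavingGap_nonneg_and_le n).1 i

theorem weavingGap_le_succ (n i : ℕ) : weavingGap n i ≤ weavingGap (n + 1) (i + 1) :=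
  (weavingGap_nonneg_and_le n).2.2 i

theorem weavingGap_add_le (n i : ℕ) :
    weavingGap (n + 1) i + weavingGap (n + 1) (i + 1) ≤ weavingGap (n + 2) (i + 1) := by
  linarith [weavingGap_succ n i, weavingGap_le_succ n (i + 1)]

theorem two_le_weavingGap_zero (n : ℕ) : 2 ≤ weavingGap (n + 2) 0 := by
  linarith [weavingGap_zero n, weavingGap_le_succ n 0]

theorem weavingGap_pos (n i : ℕ) (h : i < n) : 0 < weavingGap n i := by
  induction i generalizing n with
  | zero =>
    match n with
    | 1 => simp [weavingGap, weavingCoeff]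
    | n + 2 => linarith [two_le_weavingGap_zero n]
  | succ i ih =>
    obtain ⟨n, rfl⟩ : ∃ m, n = m + 1 := ⟨n - 1, by lia⟩
    exact (ih n (by lia)).trans_le (weavingGap_le_succ n i)

/-- Index 1 grows at least linearly, gaining at least 2 per step from index 0. Index 0 inherits this
with a delay of two steps, and the diagonal inequality passes it to higher indices. -/
theorem tendsto_weavingGap (i : ℕ) : Tendsto (fun n => weavingGap n i) atTop atTop := by
  have h₁ (n : ℕ) : (n : ℤ) ≤ weavingGap (n + 2) 1 := by
    induction n with
    | zero => exact weavingGap_nonneg _ _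
    | succ n ih =>
      push_cast
      linarith [weavingGap_add_le (n + 1) 0, two_le_weavingGap_zero n]
  have h₁' : Tendsto (fun n => weavingGap n 1) atTop atTop :=
    (tendsto_add_atTop_iff_nat 2).1 (tendsto_atTop_mono h₁ tendsto_natCast_atTop_atTop)
  induction i with
  | zero =>
    have h₀ (n : ℕ) : weavingGap (n + 1) 1 ≤ weavingGap (n + 3) 0 := by
      linarith [weavingGap_zero (n + 1), weavingGap_add_le n 0, weavingGap_succ n 0,
        weavingGap_le_succ n 1]
    exact (tendsto_add_atTop_iff_nat 3).1
      (tendsto_atTop_mono h₀ ((tendsto_add_atTop_iff_nat 1).2 h₁'))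
  | succ i ih =>
    exact (tendsto_add_atTop_iff_nat 1).1
      (tendsto_atTop_mono (fun n => weavingGap_le_succ n i) ih)

theorem weavingCoeff_nonneg (n : ℕ) (i : ℤ) : 0 ≤ weavingCoeff n i := by
  have key (j k : ℕ) : weavingCoeff n (j + k : ℕ) ≤ weavingCoeff n j := by
    induction k with
    | zero => simp
    | succ k ih =>
      have := weavingGap_nonneg n (j + k)
      simp only [weavingGap] at this
      push_cast at *
      rw [← add_assoc]
      linarith
  have nat (j : ℕ) : 0 ≤ weavingCoeff n j := by
    have := key j n
    rwa [weavingCoeff_eq_zero n (j + n : ℕ) (by grind)] at this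
  obtain ⟨j, rfl | rfl⟩ := i.eq_nat_or_neg
  · exact nat j
  · rw [weavingCoeff_neg]; exact nat j

theorem abs_coeff_weavingPoly (n : ℕ) (i : ℤ) :
    |(weavingPoly n).coeff i| = weavingCoeff n i := by
  rw [coeff_weavingPoly, abs_mul, Int.abs_negOnePow, one_mul, abs_of_nonneg (weavingCoeff_nonneg n i)]

/-! ### Perturbation by a fixed Laurent polynomial -/

theorem exists_coeff_bounds (C : ℤ[T;T⁻¹]) :
    ∃ K : ℕ, (∀ i, |C.coeff i| ≤ K) ∧ ∀ i : ℤ, (K : ℤ) < |i| → C.coeff i = 0 := by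
  have hle (i : ℤ) (h : C.coeff i ≠ 0) :
      (C.coeff i).natAbs + i.natAbs ≤ ∑ j ∈ C.coeff.support, ((C.coeff j).natAbs + j.natAbs) :=
    Finset.single_le_sum (f := fun j => (C.coeff j).natAbs + j.natAbs)
      (fun _ _ => Nat.zero_le _) (Finsupp.mem_support_iff.2 h)
  -- One number bounds both the coefficients and the exponents in the support.
  refine ⟨∑ i ∈ C.coeff.support, ((C.coeff i).natAbs + i.natAbs), fun i => ?_, fun i hi => ?_⟩
  · by_cases h : C.coeff i = 0
    · rw [h, abs_zero]
      exact Int.natCast_nonneg _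
    · rw [Int.abs_eq_natAbs]
      exact_mod_cast (Nat.le_add_right _ _).trans (hle i h)
  · by_contra h
    rw [Int.abs_eq_natAbs, Nat.cast_lt] at hi
    have := hle i h
    lia

theorem eventually_abs_coeff_add_lt (C : ℤ[T;T⁻¹]) :
    ∀ᶠ n in atTop, (∀ i : ℕ, i < n →
      |(weavingPoly n + C).coeff ((i : ℤ) + 1)| < |(weavingPoly n + C).coeff (i : ℤ)|) ∧
      ∀ i : ℤ, (n : ℤ) ≤ |i| → (weavingPoly n + C).coeff i = 0 := by
  obtain ⟨K, hK, hK'⟩ := exists_coeff_bounds C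
  -- Two neighbouring coefficients move by at most K each, so a gap of 2K + 1 stays positive; only
  -- the indices up to K are affected.
  have hgap : ∀ᶠ n in atTop, ∀ i ∈ Finset.range (K + 1), (2 * K + 1 : ℤ) ≤ weavingGap n i :=
    (Finset.eventually_all _).2 fun i _ => (tendsto_weavingGap i).eventually_ge_atTop _
  filter_upwards [hgap, eventually_gt_atTop K] with n hn hnK
  refine ⟨fun i hi => ?_, fun i hi => ?_⟩
  · have a₁ := abs_add_le ((weavingPoly n).coeff ((i : ℤ) + 1)) (C.coeff ((i : ℤ) + 1))
    have a₂ := abs_sub_abs_le_abs_sub ((weavingPoly n).coeff (i : ℤ)) (-C.coeff (i : ℤ))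
    rw [abs_neg, sub_neg_eq_add] at a₂
    rw [abs_coeff_weavingPoly] at a₁ a₂
    simp only [AddMonoidAlgebra.coeff_add, Finsupp.add_apply]
    by_cases h : i ≤ K
    · have := hn i (Finset.mem_range.2 (by lia))
      simp only [weavingGap] at this
      linarith [hK i, hK (i + 1)]
    · have := weavingGap_pos n i hi
      simp only [weavingGap] at this
      rw [hK' i (by grind), abs_zero] at a₂
      rw [hK' (i + 1) (by grind), abs_zero] at a₁
      rw [hK' i (by grind)]
      rw [hK' (i + 1) (by grind)]
      linarith
  · rw [AddMonoidAlgebra.coeff_add, Finsupp.add_apply, hK' i (by lia), coeff_weavingPoly,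
      weavingCoeff_eq_zero n i hi]
    simp

theorem eventually_isTrapezoidal (C : ℤ[T;T⁻¹])
    (hsymm : ∀ n, ∀ i : ℤ, (weavingPoly n + C).coeff (-i) = (weavingPoly n + C).coeff i) :
    ∀ᶠ n in atTop, IsTrapezoidal (weavingPoly n + C) (n - 1) ∧
      ∀ i : ℕ, 0 ≤ |(weavingPoly n + C).coeff (i : ℤ)|
        - |(weavingPoly n + C).coeff ((i : ℤ) + 1)| := by
  filter_upwards [eventually_abs_coeff_add_lt C, eventually_ge_atTop 1] with n ⟨h₁, h₂⟩ hn
  -- The plateau is the single index k = 0: the decrease is strict from the centre.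
  refine ⟨⟨fun i => by rw [hsymm], fun i hi => h₂ i (by lia), 0, Nat.zero_le _,
    fun i hi => absurd hi (Nat.not_lt_zero _), fun i _ hi => h₁ i (by lia)⟩, fun i => ?_⟩
  by_cases h : i < n
  · exact sub_nonneg.2 (h₁ i h).le
  · rw [h₂ (i + 1) (by grind), abs_zero, sub_zero]
    exact abs_nonneg _

theorem weavingGap_le_weavingCoeff (n i : ℕ) : weavingGap n i ≤ weavingCoeff n i :=
  sub_le_self _ (weavingCoeff_nonneg _ _)

theorem eventually_abs_coeff_le (C : ℤ[T;T⁻¹]) (ε : ℝ) (hε : 0 < ε) :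
    ∀ᶠ n in atTop, ∀ i : ℤ, |((C.coeff i : ℤ) : ℝ)| ≤ ε * |(((weavingPoly n).coeff i : ℤ) : ℝ)| := by
  obtain ⟨K, hK, hK'⟩ := exists_coeff_bounds C
  -- A coefficient is at least its gap, so gaps of K/ε on the support of `C` suffice.
  have hgap : ∀ᶠ n in atTop, ∀ i ∈ Finset.range (K + 1), ⌈K / ε⌉ ≤ weavingGap n i :=
    (Finset.eventually_all _).2 fun i _ => (tendsto_weavingGap i).eventually_ge_atTop _
  filter_upwards [hgap] with n hn i
  by_cases h : (K : ℤ) < |i|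
  · rw [hK' i h]
    simp only [Int.cast_zero, abs_zero]
    positivity
  · have hi : weavingCoeff n i = weavingCoeff n i.natAbs := by
      obtain ⟨j, rfl | rfl⟩ := i.eq_nat_or_neg
      · simp
      · rw [weavingCoeff_neg]; simp
    rw [Int.abs_eq_natAbs] at h
    have h₁ := (hn i.natAbs (Finset.mem_range.2 (by lia))).trans
      (weavingGap_le_weavingCoeff n _)
    rw [← hi] at h₁
    have h₂ : K / ε ≤ (weavingCoeff n i : ℝ) := (Int.le_ceil _).trans (by exact_mod_cast h₁)
    rw [← Int.cast_abs, ← Int.cast_abs, abs_coeff_weavingPoly]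
    calc ((|C.coeff i| : ℤ) : ℝ) ≤ K := by exact_mod_cast hK i
      _ ≤ ε * weavingCoeff n i := by rwa [div_le_iff₀' hε] at h₂

end ClosedBraid

end

/-- The Laurent variable `T` is `t = q ^ 2`, so the coefficient of `T ^ i` is the coefficient of
`q ^ (2 i)`. For every fixed `ℓ`, "`n ≫ ℓ`" means: for all sufficiently large `n`. -/
theorem mainTheorem5 (ℓ : ℤ) :
    ∃ Δ Δ₀ : ℕ → LaurentPolynomial ℤ,
      (∀ n : ℕ, 1 ≤ n →
        ClosedBraid.IsAlexanderPolynomial (ClosedBraid.weavingBraid 1 1 n ℓ) (Δ n) ∧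
        ClosedBraid.IsAlexanderPolynomial (ClosedBraid.weavingBraid 1 1 n 0) (Δ₀ n)) ∧
      -- asymptotic equality of the coefficients, uniformly in the exponent
      (∀ ε : ℝ, 0 < ε → ∃ N : ℕ, ∀ n : ℕ, N ≤ n → ∀ i : ℤ,
        |(((Δ n).coeff i : ℤ) : ℝ) - (((Δ₀ n).coeff i : ℤ) : ℝ)|
          ≤ ε * |(((Δ₀ n).coeff i : ℤ) : ℝ)|) ∧
      -- trapezoidal behaviour for all large `n`
      (∃ N : ℕ, 1 ≤ N ∧ ∀ n : ℕ, N ≤ n →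
        ClosedBraid.IsTrapezoidal (Δ n) (n - 1) ∧
        ClosedBraid.IsTrapezoidal (Δ₀ n) (n - 1) ∧
        ∀ i : ℕ,
          0 ≤ |(Δ n).coeff (i : ℤ)| - |(Δ n).coeff ((i : ℤ) + 1)| ∧
          0 ≤ |(Δ₀ n).coeff (i : ℤ)| - |(Δ₀ n).coeff ((i : ℤ) + 1)|) := by
  open ClosedBraid Filter in
  obtain ⟨C, hC⟩ := exists_twistCorrection ℓ
  have hA (n : ℕ) := isAlexanderPolynomial_weavingBraid n ℓ C hC
  -- For ℓ = 0 the correction is 0.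
  have hA₀ (n : ℕ) := isAlexanderPolynomial_weavingBraid n 0 0
    (by rw [mul_zero, neg_zero, LaurentPolynomial.T_zero]; norm_num)
  have ht := eventually_isTrapezoidal C fun n => (hA n).symm
  have ht₀ := eventually_isTrapezoidal 0 fun n => (hA₀ n).symm
  simp only [add_zero] at hA₀ ht₀
  refine ⟨fun n => weavingPoly n + C, weavingPoly, fun n _ => ⟨hA n, hA₀ n⟩, fun ε hε => ?_, ?_⟩
  · obtain ⟨N, hN⟩ := eventually_atTop.1 (eventually_abs_coeff_le C ε hε)
    refine ⟨N, fun n hn i => ?_⟩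
    simpa using hN n hn i
  · obtain ⟨N, hN⟩ := eventually_atTop.1 (ht.and ht₀)
    refine ⟨N + 1, by lia, fun n hn => ?_⟩
    obtain ⟨⟨h₁, h₂⟩, h₃, h₄⟩ := hN n (by lia)
    exact ⟨h₁, h₃, fun i => ⟨h₂ i, h₄ i⟩⟩
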